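/- Let $\Phi:\mathbb R\to\mathbb R$ be strictly convex, let $\Psi(\zeta)=\sup_{\nu\in\mathbb R}(\zeta\nu-\Phi(\nu))$ be its Legendre transform, and assume that $\Psi$ is finite and twice continuously differentiable with $0<c\le\Psi''(\zeta)\le C<\infty$ for all $\zeta\in\mathbb R$ and some constants $c,C$. Notation. For a $2\pi$-periodic function $P$ write $\langle P\rangle=\frac1{2\pi}\int_{-\pi}^{\pi}P(\varphi)\,d\varphi$. For $q\in\mathbb R$ put $\Psi_q(\zeta)=\Psi(q+\zeta)-\Psi'(q)\zeta-\Psi(q)$. For $0<k<\pi$ and $0<\kappa\le\pi/2$ put $$(\mathcal A_kQ)(\varphi)=\tfrac12\int_{\varphi-k}^{\varphi+k}Q(x)\,dx,\qquad \widehat{\mathcal B}_\kappa=\kappa^{-1}\mathcal A_\kappa,\qquad \widetilde{\mathcal B}_\kappa=\kappa^{-1}\mathcal A_{\pi-\kappa},\qquad (\nabla_kP)(\varphi)=\tfrac12\big(P(\varphi+k)-P(\varphi-k)\big).$$ Let $\mathcal C$ be the cone of all $2\pi$-periodic functions $Q$, square-integrable on $[-\pi,\pi]$, with $\langle Q\rangle=0$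 that are even and unimodal, i.e. $Q(-\varphi_2)=Q(\varphi_2)\le Q(\varphi_1)$ for almost all $0\le\varphi_1\le\varphi_2\le\pi$. Theorem. For all $0<\kappa\le\pi/2$, $q\in\mathbb R$ and $\gamma>0$ there exist continuous profiles $\widehat Q,\widetilde Q\in\mathcal C$, normalized by $$\langle\Psi_q(\widehat Q)\rangle=\langle\Psi_q(\widetilde Q)\rangle=\gamma ,$$ and multipliers $\widehat\sigma,\widetilde\sigma>0$ and $\widehat\eta,\widetilde\eta\in\mathbb R$ such that, everywhere on $\mathbb R$, $$\widehat\sigma\big(\Psi_q'(\widehat Q)-\widehat\eta\big)=\widehat{\mathcal B}_\kappa\widehat Q,\qquad \widetilde\sigma\big(\Psi_q'(\widetilde Q)-\widetilde\eta\big)=\widetilde{\mathcal B}_\kappa\widetilde Q .$$ Moreover, $\widehat V=\Psi_q'(\widehat Q)-\widehat\eta$ and $\widetilde V=\Psi_q'(\widetilde Q)-\widetilde\eta$ belong to $\mathcal C$, are differentiable, and satisfy $$\widehat\omega\,\widehat V'=\nabla_\kappa\,\Phi'(\widehat v+\widehat V),\qquad \widetilde\omega\,\widetilde V'=\nabla_{\pi-\kappa}\,\Phi'(\widetilde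 v+\widetilde V)$$ with $\widehat\omega=\kappa\widehat\sigma>0$, $\widehat v=\widehat\eta+\Psi'(q)$, $\widetilde\omega=\kappa\widetilde\sigma>0$, $\widetilde v=\widetilde\eta+\Psi'(q)$. The functions $\widehat Q,\widetilde Q,\widehat V,\widetilde V$ are even and non-decreasing on $[-\pi,0]$ at every point, not only almost everywhere. Consequently, for $(k,\omega,v,V)=(\kappa,\widehat\omega,\widehat v,\widehat V)$ and for $(k,\omega,v,V)=(\pi-\kappa,\widetilde\omega,\widetilde v,\widetilde V)$ the function $u_j(t)=v+V(kj-\omega t)$ is a $2\pi$-periodic wavetrain of the centred lattice $$2\dot u_j+\Phi'(u_{j+1})-\Phi'(u_{j-1})=0\qquad(j\in\mathbb Z),$$ and its dual profile is the given one: $\Phi'(v+V)=q+Q$ with $q=\langle\Phi'(v+V)\rangle$ and $Q=\widehat Q$ or $Q=\widetilde Q$ respectively. In particular $q$ and $\gamma$ are determined by the wavetrain, so that the wavetrains form a three-parameter family with parameters $k\in(0,\pi)$, $q\in\mathbb R$, $\gamma>0$. -/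

import Mathlib

open scoped Real
open MeasureTheory

noncomputable section

namespace Wavetrain

/-- `Ψ` is the Legendre transform of `Φ`: `Ψ ζ = sup_ν (ζ ν - Φ ν)`, a finite supremum. -/
def IsLegendreTransform (Φ Ψ : ℝ → ℝ) : Prop :=
  ∀ ζ : ℝ, IsLUB (Set.range fun ν : ℝ => ζ * ν - Φ ν) (Ψ ζ)

/-- The normalized dual potential `Ψ_q(ζ) = Ψ(q + ζ) - Ψ'(q) ζ - Ψ(q)`. -/
def normPot (Ψ : ℝ → ℝ) (q ζ : ℝ) : ℝ :=
  Ψ (q + ζ) - deriv Ψ q * ζ - Ψ q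

/-- The integral mean value over the periodicity cell `[-π, π]`. -/
def mean (P : ℝ → ℝ) : ℝ :=
  (1 / (2 * π)) * ∫ φ in (-π)..π, P φ

/-- The integral operator `(A_k Q)(φ) = 1/2 ∫_{φ-k}^{φ+k} Q`. -/
def opA (k : ℝ) (Q : ℝ → ℝ) (φ : ℝ) : ℝ :=
  (1 / 2) * ∫ x in (φ - k)..(φ + k), Q x

/-- The operator `κ⁻¹ A_κ`. -/
def opBHat (κ : ℝ) (Q : ℝ → ℝ) (φ : ℝ) : ℝ :=
  κ⁻¹ * opA κ Q φ

/-- The operator `κ⁻¹ A_{π-κ}`. -/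
def opBTilde (κ : ℝ) (Q : ℝ → ℝ) (φ : ℝ) : ℝ :=
  κ⁻¹ * opA (π - κ) Q φ

/-- The centred difference `(∇_k P)(φ) = (P(φ + k) - P(φ - k)) / 2`. -/
def nabla (k : ℝ) (P : ℝ → ℝ) (φ : ℝ) : ℝ :=
  (1 / 2) * (P (φ + k) - P (φ - k))

/-- Membership in the cone of (representatives of) `2π`-periodic, square-integrable, zero-mean
functions with `Q(-φ₂) = Q(φ₂) ≤ Q(φ₁)` for almost all `0 ≤ φ₁ ≤ φ₂ ≤ π`. -/
structure InCone (Q : ℝ → ℝ) : Prop where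
  periodic : Function.Periodic Q (2 * π)
  memLp : MemLp Q 2 (volume.restrict (Set.Icc (-π) π))
  mean_zero : mean Q = 0
  shape : ∀ᵐ p : ℝ × ℝ, 0 ≤ p.1 → p.1 ≤ p.2 → p.2 ≤ π →
    Q (-p.2) = Q p.2 ∧ Q p.2 ≤ Q p.1

/-- Everywhere even, and unimodal on `[-π, π]` with its maximum at the origin. -/
def IsEvenUnimodal (P : ℝ → ℝ) : Prop :=
  Function.Even P ∧ MonotoneOn P (Set.Icc (-π) 0)

/-- The constraint functional of the potential `Ψ_q`: the mean of `Ψ_q(Q)`. -/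
def energyW (Ψ : ℝ → ℝ) (q : ℝ) (Q : ℝ → ℝ) : ℝ :=
  mean fun φ => normPot Ψ q (Q φ)

/-- The profile `V = Ψ_q'(Q) - η` that belongs to a dual profile `Q`. -/
def profile (Ψ : ℝ → ℝ) (q η : ℝ) (Q : ℝ → ℝ) (φ : ℝ) : ℝ :=
  deriv (normPot Ψ q) (Q φ) - η

/-- `u` solves the centred lattice `2 u_j' + Φ'(u_{j+1}) - Φ'(u_{j-1}) = 0`. -/
def IsLatticeSolution (Φ : ℝ → ℝ) (u : ℤ → ℝ → ℝ) : Prop :=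
  ∀ j : ℤ, Differentiable ℝ (u j) ∧
    ∀ t : ℝ, 2 * deriv (u j) t + deriv Φ (u (j + 1) t) - deriv Φ (u (j - 1) t) = 0

/-- `V` is the zero-mean part of the profile of a `2π`-periodic wavetrain with wave number `k`,
frequency `ω` and average `v`: it solves `ω V' = ∇_k Φ'(v + V)` classically, and
`u_j(t) = v + V(k j - ω t)` solves the lattice. -/
structure IsWavetrain (Φ : ℝ → ℝ) (k ω v : ℝ) (V : ℝ → ℝ) : Prop where
  periodic : Function.Periodic V (2 * π)
  mean_zero : mean V = 0
  differentiable : Differentiable ℝ V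
  equation : ∀ φ : ℝ, ω * deriv V φ = nabla k (fun x => deriv Φ (v + V x)) φ
  lattice : IsLatticeSolution Φ fun j t => v + V (k * (j : ℝ) - ω * t)

/-- `Q` is the dual profile, and `q` its average, of the wavetrain `v + V`:
`Φ'(v + V) = q + Q` where `q` is the mean of `Φ'(v + V)`. -/
def IsDualProfile (Φ : ℝ → ℝ) (v : ℝ) (V : ℝ → ℝ) (q : ℝ) (Q : ℝ → ℝ) : Prop :=
  (∀ φ : ℝ, deriv Φ (v + V φ) = q + Q φ) ∧ q = mean fun φ => deriv Φ (v + V φ)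

end Wavetrain

end

/-!
Both wavetrains are instances of one existence result, for an arbitrary wave number `k ∈ (0, π)`.
Put `F = Ψ_q` and `f = Ψ_q'`; then `f` is increasing with slopes in `[c, C]`, and so has an inverse
`g`. The idea is to maximize the quadratic form `W(Q) = ∫ Q · A_k Q` over the profiles `Q` of the
cone with `∫ F(Q) ≤ Γ = 2πγ`. Although `A_k` is not positive semi-definite, a maximizer solves the
equation without any extra multiplier from the shape constraint, for two reasons.

* The cone is invariant: `A_k` maps even unimodal profiles to such profiles (`IsProfile.opA`), and
  so does `R = g (s A_k Q + η)` for `s > 0`. The multipliers `s > 0` and `η` can be chosen such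
  that `R` has zero mean and energy exactly `Γ` (`PinchedPotential.exists_multipliers`, two
  applications of the intermediate value theorem).
* By uniform convexity of `F`, testing `f(R) = s A_k Q + η` with `R - Q` yields
  `c/2 ∫ (R - Q)² ≤ s ∫ A_k Q · (R - Q)` (`PinchedPotential.improvement`). As the admissible set is
  convex, the segment from `Q` to `R` is admissible, and maximality of `Q` makes the right-hand side
  non-positive (`integral_opA_mul_sub_nonpos`). Hence `R = Q`.

For the existence of a maximizer no weak topology is needed. The multiplier `s` and the functions
`A_k Q` obey explicit bounds, once `W(Q)` is at least the value of `W` at a small multiple of the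
cosine; thus `R` is bounded and Lipschitz continuous with known constants `M` and `L`. Adding these
two bounds to the definition of the admissible set (`IsAdmissible`) keeps it convex, keeps `R`
admissible, and makes it compact in the uniform topology by Arzelà-Ascoli (`exists_maximizer`).

Finally `Φ'` inverts `Ψ'` (`deriv_legendre_comp`), since the Legendre supremum is attained. So
`V = f(Q) - η` satisfies `Φ'(v + V) = q + Q`, and differentiating `V = s A_k Q` gives the travelling
wave equation and the lattice equation.
-/

namespace Wavetrain

/-! ### Potentials with pinched second derivative -/

/-- A function with monotone derivative lies above its tangent lines. -/
lemma tangent_le_of_monotone_deriv {G g : ℝ → ℝ} (hG : ∀ x, HasDerivAt G (g x) x)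
    (hg : Monotone g) (x y : ℝ) : G x + g x * (y - x) ≤ G y := by
  have hc : Continuous G := continuous_iff_continuousAt.2 fun x => (hG x).continuousAt
  rcases lt_trichotomy x y with h | h | h
  · obtain ⟨z, hz, hzeq⟩ := exists_hasDerivAt_eq_slope G g h hc.continuousOn fun t _ => hG t
    rw [eq_div_iff (by linarith)] at hzeq
    nlinarith [hg hz.1.le]
  · subst h; simp
  · obtain ⟨z, hz, hzeq⟩ := exists_hasDerivAt_eq_slope G g h hc.continuousOn fun t _ => hG t
    rw [eq_div_iff (by linarith)] at hzeq
    nlinarith [hg hz.2.le]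

/-- A normalized convex potential `F` with derivative `f`, where `c ≤ f' ≤ C` is encoded by the
difference quotients of `f`, together with the inverse function `g` of `f`. -/
structure PinchedPotential (c C : ℝ) (F f g : ℝ → ℝ) : Prop where
  c_pos : 0 < c
  c_le_C : c ≤ C
  hasDerivAt : ∀ x, HasDerivAt F (f x) x
  lower : ∀ x y, x ≤ y → c * (y - x) ≤ f y - f x
  upper : ∀ x y, x ≤ y → f y - f x ≤ C * (y - x)
  F_zero : F 0 = 0
  f_zero : f 0 = 0
  right_inv : ∀ a, f (g a) = a

namespace PinchedPotential

variable {c C : ℝ} {F f g : ℝ → ℝ}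

lemma C_pos (h : PinchedPotential c C F f g) : 0 < C := h.c_pos.trans_le h.c_le_C

lemma lower_quad (h : PinchedPotential c C F f g) (x y : ℝ) :
    F x + f x * (y - x) + c / 2 * (y - x) ^ 2 ≤ F y := by
  have := tangent_le_of_monotone_deriv (G := fun t => F t - c / 2 * t ^ 2)
    (g := fun t => f t - c * t) (fun t => by
      exact ((h.hasDerivAt t).sub ((hasDerivAt_pow 2 t).const_mul (c / 2))).congr_deriv
        (by push_cast; ring)) (fun a b hab => by have := h.lower a b hab; simp only; linarith) x y
  linarith

lemma upper_quad (h : PinchedPotential c C F f g) (x : ℝ) : F x ≤ C / 2 * x ^ 2 := by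
  have := tangent_le_of_monotone_deriv (G := fun t => C / 2 * t ^ 2 - F t)
    (g := fun t => C * t - f t) (fun t => by
      exact (((hasDerivAt_pow 2 t).const_mul (C / 2)).sub (h.hasDerivAt t)).congr_deriv
        (by push_cast; ring)) (fun a b hab => by have := h.upper a b hab; simp only; linarith) 0 x
  simp only [h.F_zero, h.f_zero] at this
  nlinarith

lemma lower_sq (h : PinchedPotential c C F f g) (x : ℝ) : c / 2 * x ^ 2 ≤ F x := by
  have := h.lower_quad 0 x
  simp only [h.F_zero, h.f_zero] at this
  nlinarith

lemma mul_self_le (h : PinchedPotential c C F f g) (x : ℝ) : f x * x ≤ C * x ^ 2 := by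
  rcases le_total 0 x with hx | hx
  · have := h.upper 0 x hx
    rw [h.f_zero] at this
    nlinarith
  · have := h.upper x 0 hx
    rw [h.f_zero] at this
    nlinarith

lemma strictMono (h : PinchedPotential c C F f g) : StrictMono f := fun x y hxy => by
  have := h.lower x y hxy.le
  have := mul_pos h.c_pos (sub_pos.2 hxy)
  linarith

lemma left_inv (h : PinchedPotential c C F f g) (x : ℝ) : g (f x) = x :=
  h.strictMono.injective (h.right_inv _)

lemma inv_zero (h : PinchedPotential c C F f g) : g 0 = 0 := by
  simpa [h.f_zero] using h.left_inv 0

lemma inv_strictMono (h : PinchedPotential c C F f g) : StrictMono g := fun a b hab => by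
  rw [← h.strictMono.lt_iff_lt, h.right_inv, h.right_inv]; exact hab

lemma inv_upper (h : PinchedPotential c C F f g) {a b : ℝ} (hab : a ≤ b) :
    g b - g a ≤ (b - a) / c := by
  have := h.lower (g a) (g b) (h.inv_strictMono.monotone hab)
  rw [h.right_inv, h.right_inv] at this
  rw [le_div_iff₀ h.c_pos]; linarith

lemma inv_lower (h : PinchedPotential c C F f g) {a b : ℝ} (hab : a ≤ b) :
    (b - a) / C ≤ g b - g a := by
  have := h.upper (g a) (g b) (h.inv_strictMono.monotone hab)
  rw [h.right_inv, h.right_inv] at this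
  rw [div_le_iff₀ h.C_pos]; linarith

lemma abs_inv_sub_le (h : PinchedPotential c C F f g) (a b : ℝ) :
    |g a - g b| ≤ |a - b| / c := by
  rcases le_total a b with hab | hab
  · have h1 := h.inv_strictMono.monotone hab
    rw [abs_sub_comm, abs_sub_comm a, abs_of_nonneg (by linarith), abs_of_nonneg (by linarith)]
    exact h.inv_upper hab
  · have h1 := h.inv_strictMono.monotone hab
    rw [abs_of_nonneg (by linarith), abs_of_nonneg (by linarith)]
    exact h.inv_upper hab

/-- Increments of the inverse function, tested against the increment of the argument. -/
lemma sq_div_le_mul_inv_sub (h : PinchedPotential c C F f g) (a b : ℝ) :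
    (a - b) ^ 2 / C ≤ (a - b) * (g a - g b) := by
  rcases le_total a b with hab | hab
  · have := mul_le_mul_of_nonneg_left (h.inv_lower hab) (sub_nonneg.2 hab)
    calc (a - b) ^ 2 / C = (b - a) * ((b - a) / C) := by ring
      _ ≤ _ := by linarith
  · have := mul_le_mul_of_nonneg_left (h.inv_lower hab) (sub_nonneg.2 hab)
    calc (a - b) ^ 2 / C = (a - b) * ((a - b) / C) := by ring
      _ ≤ _ := by linarith

lemma continuous_pot (h : PinchedPotential c C F f g) : Continuous F :=
  continuous_iff_continuousAt.2 fun x => (h.hasDerivAt x).continuousAt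

lemma continuous_inv (h : PinchedPotential c C F f g) : Continuous g :=
  (LipschitzWith.of_dist_le_mul (K := ⟨1 / c, (one_div_pos.2 h.c_pos).le⟩) fun a b => by
    rw [Real.dist_eq, Real.dist_eq]
    refine (h.abs_inv_sub_le a b).trans_eq ?_
    change _ = 1 / c * |a - b|
    ring).continuous

lemma continuous_deriv (h : PinchedPotential c C F f g) : Continuous f :=
  h.strictMono.monotone.continuous_of_surjective fun x => ⟨g x, h.right_inv x⟩

end PinchedPotential

/-- A function whose derivative is bounded below by a positive constant is onto. -/
lemma surjective_of_le_deriv {f f' : ℝ → ℝ} {c : ℝ} (hc : 0 < c)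
    (hf : ∀ x, HasDerivAt f (f' x) x) (h : ∀ x, c ≤ f' x) : Function.Surjective f := by
  have hd : Differentiable ℝ f := fun x => (hf x).differentiableAt
  have hl : ∀ x y, x ≤ y → c * (y - x) ≤ f y - f x := fun x y hxy =>
    Convex.mul_sub_le_image_sub_of_le_deriv convex_univ hd.continuous.continuousOn
      hd.differentiableOn (fun x _ => by rw [(hf x).deriv]; exact h x) x trivial y trivial hxy
  refine hd.continuous.surjective ?_ ?_
  · refine Filter.tendsto_atTop_mono' _ (f₁ := fun x => c * x + f 0) ?_
      (Filter.tendsto_atTop_add_const_right _ _ (Filter.tendsto_id.const_mul_atTop hc))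
    filter_upwards [Filter.eventually_ge_atTop 0] with x hx
    linarith [hl 0 x hx]
  · refine Filter.tendsto_atBot_mono' _ (f₁ := fun x => c * x + f 0) ?_
      (Filter.tendsto_atBot_add_const_right _ _ (Filter.tendsto_id.const_mul_atBot hc))
    filter_upwards [Filter.eventually_le_atBot 0] with x hx
    linarith [hl x 0 hx]

lemma hasDerivAt_deriv_of_contDiff_two {Ψ : ℝ → ℝ} (hΨ : ContDiff ℝ 2 Ψ) (x : ℝ) :
    HasDerivAt Ψ (deriv Ψ x) x ∧ HasDerivAt (deriv Ψ) (deriv (deriv Ψ) x) x := by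
  have h1 : ContDiff ℝ 1 (deriv Ψ) := by
    have : ContDiff ℝ (1 + 1) Ψ := by simpa [one_add_one_eq_two] using hΨ
    exact (contDiff_succ_iff_deriv.1 this).2.2
  exact ⟨((hΨ.differentiable (by norm_num)) x).hasDerivAt,
    ((h1.differentiable (by norm_num)) x).hasDerivAt⟩

lemma hasDerivAt_normPot {Ψ : ℝ → ℝ} (hΨ : ContDiff ℝ 2 Ψ) (q x : ℝ) :
    HasDerivAt (normPot Ψ q) (deriv Ψ (q + x) - deriv Ψ q) x := by
  have h1 := (hasDerivAt_deriv_of_contDiff_two hΨ (q + x)).1.comp_const_add q x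
  have h2 := (h1.sub ((hasDerivAt_id x).const_mul (deriv Ψ q))).sub_const (Ψ q)
  rw [mul_one] at h2
  exact h2

lemma exists_pinchedPotential_normPot {Ψ : ℝ → ℝ} (hΨ : ContDiff ℝ 2 Ψ) {c C : ℝ} (hc : 0 < c)
    (hb : ∀ ζ, c ≤ deriv (deriv Ψ) ζ ∧ deriv (deriv Ψ) ζ ≤ C) (q : ℝ) :
    ∃ g, PinchedPotential c C (normPot Ψ q) (deriv (normPot Ψ q)) g := by
  have h1 : deriv (normPot Ψ q) = fun x => deriv Ψ (q + x) - deriv Ψ q :=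
    funext fun x => (hasDerivAt_normPot hΨ q x).deriv
  have hd : ∀ x, HasDerivAt (deriv (normPot Ψ q)) (deriv (deriv Ψ) (q + x)) x := fun x => by
    rw [h1]
    exact ((hasDerivAt_deriv_of_contDiff_two hΨ (q + x)).2.comp_const_add q x).sub_const _
  have hdiff : Differentiable ℝ (deriv (normPot Ψ q)) := fun x => (hd x).differentiableAt
  obtain ⟨g, hg⟩ := (surjective_of_le_deriv hc hd fun x => (hb _).1).hasRightInverse
  refine ⟨g, hc, (hb 0).1.trans (hb 0).2, fun x => ?_, fun x y hxy => ?_, fun x y hxy => ?_,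
    by simp [normPot], by simp [h1], hg⟩
  · rw [h1]; exact hasDerivAt_normPot hΨ q x
  · exact Convex.mul_sub_le_image_sub_of_le_deriv convex_univ hdiff.continuous.continuousOn
      hdiff.differentiableOn (fun x _ => by rw [(hd x).deriv]; exact (hb _).1)
      x trivial y trivial hxy
  · exact Convex.image_sub_le_mul_sub_of_deriv_le convex_univ hdiff.continuous.continuousOn
      hdiff.differentiableOn (fun x _ => by rw [(hd x).deriv]; exact (hb _).2)
      x trivial y trivial hxy

/-! ### Legendre duality -/

/-- The Legendre supremum is attained, at the slope `Ψ' ζ`. -/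
lemma legendre_deriv_eq {Φ Ψ : ℝ → ℝ} (hΦ : ConvexOn ℝ Set.univ Φ)
    (h : IsLegendreTransform Φ Ψ) (hΨ : Differentiable ℝ Ψ) (ζ : ℝ) :
    Φ (deriv Ψ ζ) = ζ * deriv Ψ ζ - Ψ ζ := by
  have hle : ∀ ζ ν, ζ * ν - Φ ν ≤ Ψ ζ := fun ζ ν => (h ζ).1 ⟨ν, rfl⟩
  have hcont : Continuous Φ :=
    continuousOn_univ.1 (hΦ.continuousOn isOpen_univ)
  -- the bounds at `ζ ± 1` make `ν ↦ Φ ν - ζ ν` coercive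
  have hcoer : Filter.Tendsto (fun ν => Φ ν - ζ * ν) (Filter.cocompact ℝ) Filter.atTop := by
    refine Filter.tendsto_atTop_mono (f := fun ν => ‖ν‖ + (-(max (Ψ (ζ + 1)) (Ψ (ζ - 1)))))
      (fun ν => ?_) (Filter.tendsto_atTop_add_const_right _ _ tendsto_norm_cocompact_atTop)
    have h1 := hle (ζ + 1) ν
    have h2 := hle (ζ - 1) ν
    have h3 := le_max_left (Ψ (ζ + 1)) (Ψ (ζ - 1))
    have h4 := le_max_right (Ψ (ζ + 1)) (Ψ (ζ - 1))
    rw [Real.norm_eq_abs]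
    rcases abs_cases ν with ⟨h5, _⟩ | ⟨h5, _⟩ <;> rw [h5] <;> linarith
  obtain ⟨ν, hν⟩ := Continuous.exists_forall_le (f := fun ν => Φ ν - ζ * ν) (by fun_prop) hcoer
  have hatt : Ψ ζ = ζ * ν - Φ ν := by
    refine (h ζ).unique (IsGreatest.isLUB ⟨⟨ν, rfl⟩, ?_⟩)
    rintro _ ⟨μ, rfl⟩
    have := hν μ
    simp only
    linarith
  have hmin : IsLocalMin (fun z => Ψ z - z * ν) ζ := Filter.Eventually.of_forall fun z => by
    have := hle z ν
    simp only
    linarith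
  have hd : HasDerivAt (fun z => Ψ z - z * ν) (deriv Ψ ζ - 1 * ν) ζ :=
    (hΨ ζ).hasDerivAt.sub ((hasDerivAt_id ζ).mul_const ν)
  have := hmin.hasDerivAt_eq_zero hd
  have hνeq : deriv Ψ ζ = ν := by linarith
  rw [hνeq]; linarith

/-- `Φ'` inverts `Ψ'`. -/
lemma deriv_legendre_comp {Φ Ψ : ℝ → ℝ} (hΦ : ConvexOn ℝ Set.univ Φ)
    (h : IsLegendreTransform Φ Ψ) (hΨ : ContDiff ℝ 2 Ψ) {c : ℝ} (hc : 0 < c)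
    (hb : ∀ ζ, c ≤ deriv (deriv Ψ) ζ) (ζ : ℝ) : deriv Φ (deriv Ψ ζ) = ζ := by
  have hd := hasDerivAt_deriv_of_contDiff_two hΨ
  have hmono : StrictMono (deriv Ψ) :=
    strictMono_of_deriv_pos fun x => hc.trans_le (hb x)
  have hsurj : Function.Surjective (deriv Ψ) :=
    surjective_of_le_deriv hc (fun x => (hd x).2) hb
  obtain ⟨g, hg⟩ := hsurj.hasRightInverse
  have hg' : ∀ x, g (deriv Ψ x) = x := fun x => hmono.injective (hg _)
  have hgmono : StrictMono g := fun a b hab => by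
    rw [← hmono.lt_iff_lt, hg, hg]; exact hab
  have hgc : Continuous g :=
    hgmono.monotone.continuous_of_surjective fun x => ⟨deriv Ψ x, hg' x⟩
  have hgd : HasDerivAt g (deriv (deriv Ψ) ζ)⁻¹ (deriv Ψ ζ) := by
    refine HasDerivAt.of_local_left_inverse (f := deriv Ψ) hgc.continuousAt ?_
      (hc.trans_le (hb ζ)).ne' (Filter.Eventually.of_forall hg)
    rw [hg']; exact (hd ζ).2
  have hΦeq : Φ = fun ν => g ν * ν - Ψ (g ν) := funext fun ν => by
    have := legendre_deriv_eq hΦ h (fun x => (hd x).1.differentiableAt) (g ν)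
    rwa [hg] at this
  have hcomp : HasDerivAt (fun ν => Ψ (g ν)) (deriv Ψ ζ * (deriv (deriv Ψ) ζ)⁻¹) (deriv Ψ ζ) := by
    refine HasDerivAt.comp (h₂ := Ψ) _ ?_ hgd
    rw [hg']; exact (hd ζ).1
  have := (hgd.mul (hasDerivAt_id _)).sub hcomp
  rw [hΦeq]
  refine (HasDerivAt.deriv (f' := ζ) (this.congr_deriv ?_))
  rw [hg', id]
  ring

/-! ### The averaging operator on profiles -/

/-- Continuous representatives of the elements of the cone: continuous `2π`-periodic functions of
zero mean that are even and non-decreasing on `[-π, 0]`. -/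
structure IsProfile (Q : ℝ → ℝ) : Prop where
  continuous : Continuous Q
  periodic : Function.Periodic Q (2 * π)
  integral_zero : ∫ x in (-π)..π, Q x = 0
  even_unimodal : IsEvenUnimodal Q

lemma integral_shift {Q : ℝ → ℝ} (hper : Function.Periodic Q (2 * π)) (s : ℝ) :
    ∫ x in (-π)..π, Q (x + s) = ∫ x in (-π)..π, Q x := by
  rw [intervalIntegral.integral_comp_add_right (fun x => Q x)]
  have := hper.intervalIntegral_add_eq (-π + s) (-π)
  rwa [show -π + s + 2 * π = π + s by ring, show -π + 2 * π = π by ring] at this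

lemma opA_eq (k : ℝ) (Q : ℝ → ℝ) (φ : ℝ) : opA k Q φ = 1 / 2 * ∫ s in (-k)..k, Q (φ + s) := by
  rw [opA, intervalIntegral.integral_comp_add_left (fun x => Q x), ← sub_eq_add_neg]

lemma hasDerivAt_opA {Q : ℝ → ℝ} (hQ : Continuous Q) (k φ : ℝ) :
    HasDerivAt (opA k Q) (nabla k Q φ) φ := by
  have hint : ∀ a b, IntervalIntegrable Q volume a b := fun a b => hQ.intervalIntegrable a b
  have h0 : ∀ x, HasDerivAt (fun u => ∫ t in (0 : ℝ)..u, Q t) (Q x) x := fun x =>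
    intervalIntegral.integral_hasDerivAt_right (hint _ _)
      hQ.stronglyMeasurable.stronglyMeasurableAtFilter hQ.continuousAt
  have heq : opA k Q = fun φ => 1 / 2 * ((∫ t in (0 : ℝ)..(φ + k), Q t)
      - ∫ t in (0 : ℝ)..(φ - k), Q t) := funext fun φ => by
    rw [opA, intervalIntegral.integral_interval_sub_left (hint _ _) (hint _ _)]
  rw [heq]
  exact (((h0 (φ + k)).comp_add_const φ k).sub ((h0 (φ - k)).comp_sub_const φ k)).const_mul _

lemma continuous_opA {Q : ℝ → ℝ} (hQ : Continuous Q) (k : ℝ) : Continuous (opA k Q) :=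
  continuous_iff_continuousAt.2 fun φ => (hasDerivAt_opA hQ k φ).continuousAt

lemma opA_add_smul {Q R : ℝ → ℝ} (hQ : Continuous Q) (hR : Continuous R) (k t φ : ℝ) :
    opA k (fun x => Q x + t * R x) φ = opA k Q φ + t * opA k R φ := by
  rw [opA, opA, opA, intervalIntegral.integral_add (hQ.intervalIntegrable _ _)
    ((hR.const_mul t).intervalIntegrable _ _), intervalIntegral.integral_const_mul]
  ring

lemma periodic_opA {Q : ℝ → ℝ} (hper : Function.Periodic Q (2 * π)) (k : ℝ) :
    Function.Periodic (opA k Q) (2 * π) := fun φ => by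
  rw [opA_eq, opA_eq]
  congr 1
  refine intervalIntegral.integral_congr fun s _ => ?_
  rw [← hper (φ + s)]; congr 1; ring

lemma intervalIntegral_swap_of_continuous {h : ℝ → ℝ → ℝ} (hh : Continuous h.uncurry)
    (a b c d : ℝ) : ∫ x in a..b, ∫ y in c..d, h x y = ∫ y in c..d, ∫ x in a..b, h x y :=
  intervalIntegral_intervalIntegral_swap <|
    (hh.continuousOn.integrableOn_compact (isCompact_uIcc.prod isCompact_uIcc)).mono_set
      (Set.prod_mono Set.uIoc_subset_uIcc Set.uIoc_subset_uIcc)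

lemma integral_opA_eq_zero {Q : ℝ → ℝ} (hQ : Continuous Q) (hper : Function.Periodic Q (2 * π))
    (h0 : ∫ x in (-π)..π, Q x = 0) (k : ℝ) : ∫ φ in (-π)..π, opA k Q φ = 0 := by
  simp_rw [opA_eq]
  rw [intervalIntegral.integral_const_mul, intervalIntegral_swap_of_continuous
    (h := fun φ s => Q (φ + s)) (by unfold Function.uncurry; fun_prop)]
  simp_rw [integral_shift hper, h0]
  simp

/-- `A_k` is symmetric with respect to the `L²` pairing over a period. -/
lemma integral_opA_mul_comm {Q R : ℝ → ℝ} (hQ : Continuous Q) (hR : Continuous R)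
    (hQper : Function.Periodic Q (2 * π)) (hRper : Function.Periodic R (2 * π)) (k : ℝ) :
    ∫ φ in (-π)..π, opA k Q φ * R φ = ∫ φ in (-π)..π, opA k R φ * Q φ := by
  have h1 : ∀ {Q R : ℝ → ℝ}, Continuous Q → Continuous R →
      ∫ φ in (-π)..π, opA k Q φ * R φ
        = 1 / 2 * ∫ s in (-k)..k, ∫ φ in (-π)..π, Q (φ + s) * R φ := fun {Q R} hQ hR => by
    rw [← intervalIntegral_swap_of_continuous (h := fun φ s => Q (φ + s) * R φ)
      (by unfold Function.uncurry; fun_prop), ← intervalIntegral.integral_const_mul]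
    refine intervalIntegral.integral_congr fun φ _ => ?_
    simp only [opA_eq, intervalIntegral.integral_mul_const]
    ring
  rw [h1 hQ hR, h1 hR hQ]
  congr 1
  have h2 := intervalIntegral.integral_comp_neg (a := -k) (b := k)
    (fun s => ∫ φ in (-π)..π, Q (φ + s) * R φ)
  rw [neg_neg] at h2
  rw [← h2]
  refine intervalIntegral.integral_congr fun s _ => ?_
  have hper : Function.Periodic (fun φ => Q (φ + -s) * R φ) (2 * π) := fun φ => by
    simp only [hRper φ]
    rw [show φ + 2 * π + -s = φ + -s + 2 * π by ring, hQper]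
  -- the translation by `s` moves the shift from one factor to the other
  have h3 := integral_shift hper s
  rw [← h3]
  refine intervalIntegral.integral_congr fun φ _ => ?_
  simp only [add_neg_cancel_right]
  ring

lemma IsProfile.nabla_nonneg {Q : ℝ → ℝ} (hQ : IsProfile Q) {k φ : ℝ} (hk : 0 < k) (hk' : k < π)
    (hφ : φ ∈ Set.Icc (-π) 0) : 0 ≤ nabla k Q φ := by
  obtain ⟨heven, hmono⟩ := hQ.even_unimodal
  have hper := hQ.periodic
  obtain ⟨h1, h2⟩ := hφ
  -- the distance of `φ + k` to `2πℤ` does not exceed that of `φ - k`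
  suffices h : Q (φ - k) ≤ Q (φ + k) by rw [nabla]; linarith
  have key : ∀ x y, x ∈ Set.Icc (-π) 0 → x ≤ -|y| → Q x ≤ Q y := fun x y hx hxy => by
    have h3 : Q y = Q (-|y|) := by
      rcases abs_cases y with ⟨h, _⟩ | ⟨h, _⟩ <;> rw [h]
      · exact (heven y).symm
      · rw [neg_neg]
    rw [h3]
    exact hmono hx ⟨hx.1.trans hxy, neg_nonpos.2 (abs_nonneg _)⟩ hxy
  rcases le_total (-π) (φ - k) with h3 | h3
  · refine key _ _ ⟨h3, by linarith⟩ ?_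
    rcases abs_cases (φ + k) with ⟨h, _⟩ | ⟨h, _⟩ <;> rw [h] <;> linarith
  · have h4 : Q (φ - k) = Q (-(φ - k + 2 * π)) := by rw [heven, hper]
    rw [h4]
    refine key _ _ ⟨by linarith, by linarith⟩ ?_
    rcases abs_cases (φ + k) with ⟨h, _⟩ | ⟨h, _⟩ <;> rw [h] <;> linarith

/-- `A_k` maps the cone of profiles into itself. -/
lemma IsProfile.opA {Q : ℝ → ℝ} (hQ : IsProfile Q) {k : ℝ} (hk : 0 < k) (hk' : k < π) :
    IsProfile (opA k Q) where
  continuous := continuous_opA hQ.continuous k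
  periodic := periodic_opA hQ.periodic k
  integral_zero := integral_opA_eq_zero hQ.continuous hQ.periodic hQ.integral_zero k
  even_unimodal := by
    refine ⟨fun φ => ?_, ?_⟩
    · rw [opA_eq, opA_eq]
      congr 1
      have := intervalIntegral.integral_comp_neg (a := -k) (b := k) (fun s => Q (φ + s))
      rw [neg_neg] at this
      rw [← this]
      refine intervalIntegral.integral_congr fun s _ => ?_
      rw [← hQ.even_unimodal.1]; congr 1; ring
    · refine monotoneOn_of_deriv_nonneg (convex_Icc _ _)
        (continuous_opA hQ.continuous k).continuousOn
        (fun x _ => (hasDerivAt_opA hQ.continuous k x).differentiableAt.differentiableWithinAt)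
        fun x hx => ?_
      rw [(hasDerivAt_opA hQ.continuous k x).deriv]
      exact hQ.nabla_nonneg hk hk' (interior_subset hx)

lemma abs_opA_le {Q : ℝ → ℝ} (hQ : Continuous Q) (hper : Function.Periodic Q (2 * π))
    {k : ℝ} (hk : 0 < k) (hk' : k < π) (φ : ℝ) :
    |opA k Q φ| ≤ 1 / 4 * (2 * π + ∫ x in (-π)..π, Q x ^ 2) := by
  have hint : ∀ a b, IntervalIntegrable (fun x => (1 + Q x ^ 2) / 2) volume a b := fun a b =>
    Continuous.intervalIntegrable (by fun_prop) _ _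
  have h1 : |∫ x in (φ - k)..(φ + k), Q x| ≤ ∫ x in (φ - k)..(φ + k), (1 + Q x ^ 2) / 2 := by
    rw [← Real.norm_eq_abs]
    refine intervalIntegral.norm_integral_le_of_norm_le (by linarith)
      (Filter.Eventually.of_forall fun x _ => ?_) (hint _ _)
    rw [Real.norm_eq_abs, abs_le]
    constructor <;> nlinarith [sq_nonneg (Q x - 1), sq_nonneg (Q x + 1)]
  have h2 : ∫ x in (φ - k)..(φ + k), (1 + Q x ^ 2) / 2
      ≤ ∫ x in (φ - π)..(φ + π), (1 + Q x ^ 2) / 2 := by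
    refine intervalIntegral.integral_mono_interval (by linarith) (by linarith) (by linarith)
      (Filter.Eventually.of_forall fun x => ?_) (hint _ _)
    change 0 ≤ (1 + Q x ^ 2) / 2
    positivity
  have h3 : ∫ x in (φ - π)..(φ + π), (1 + Q x ^ 2) / 2
      = 1 / 2 * (2 * π + ∫ x in (-π)..π, Q x ^ 2) := by
    have hper2 : Function.Periodic (fun x => (1 + Q x ^ 2) / 2) (2 * π) := fun x => by
      simp only [hper x]
    have := hper2.intervalIntegral_add_eq (φ - π) (-π)
    rw [show φ - π + 2 * π = φ + π by ring, show -π + 2 * π = π by ring] at this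
    rw [this, intervalIntegral.integral_div, intervalIntegral.integral_add
      (by simp) (Continuous.intervalIntegrable (by fun_prop) _ _)]
    simp; ring
  rw [opA, abs_mul, abs_of_pos (by norm_num : (0 : ℝ) < 1 / 2)]
  linarith

lemma abs_opA_sub_le {Q : ℝ → ℝ} (hQ : Continuous Q) {M : ℝ} (hM : ∀ x, |Q x| ≤ M)
    (k x y : ℝ) : |opA k Q x - opA k Q y| ≤ M * |x - y| := by
  have := Convex.norm_image_sub_le_of_norm_hasDerivWithin_le (C := M)
    (fun z _ => (hasDerivAt_opA hQ k z).hasDerivWithinAt) (fun z _ => ?_) convex_univ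
    (Set.mem_univ y) (Set.mem_univ x)
  · simpa [Real.norm_eq_abs] using this
  · have h1 := abs_le.1 (hM (z + k))
    have h2 := abs_le.1 (hM (z - k))
    rw [Real.norm_eq_abs, nabla, abs_le]
    constructor <;> linarith

lemma opA_cos (k φ : ℝ) : opA k Real.cos φ = Real.sin k * Real.cos φ := by
  rw [opA, integral_cos, Real.sin_add, Real.sin_sub]; ring

lemma isProfile_cos {ε : ℝ} (hε : 0 ≤ ε) : IsProfile fun x => ε * Real.cos x where
  continuous := by fun_prop
  periodic := fun x => by simp only [Real.cos_add_two_pi]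
  integral_zero := by simp
  even_unimodal := by
    refine ⟨fun x => by simp, fun x hx y hy hxy => ?_⟩
    refine mul_le_mul_of_nonneg_left ?_ hε
    rw [← Real.cos_neg x, ← Real.cos_neg y]
    exact Real.cos_le_cos_of_nonneg_of_le_pi (by linarith [hy.2]) (by linarith [hx.1])
      (by linarith)

/-! ### Multipliers for a prescribed right-hand side -/

namespace PinchedPotential

variable {c C : ℝ} {F f g P : ℝ → ℝ} {p : ℝ}

/-- The zero-mean condition determines the multiplier `η`. -/
lemma exists_shift (h : PinchedPotential c C F f g) (hP : Continuous P) (hp : ∀ x, |P x| ≤ p)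
    (s : ℝ) : ∃ η, ∫ x in (-π)..π, g (s * P x + η) = 0 ∧ |η| ≤ |s| * p := by
  have hg := h.continuous_inv
  have hsP : ∀ x, |s * P x| ≤ |s| * p := fun x => by
    rw [abs_mul]; exact mul_le_mul_of_nonneg_left (hp x) (abs_nonneg s)
  have hp0 : 0 ≤ |s| * p := (abs_nonneg _).trans (hsP 0)
  have hc : Continuous fun η => ∫ x in (-π)..π, g (s * P x + η) :=
    intervalIntegral.continuous_parametric_intervalIntegral_of_continuous'
      (by unfold Function.uncurry; fun_prop) _ _
  have hπ : -π ≤ π := by linarith [Real.pi_pos]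
  have hmem : (0 : ℝ) ∈ Set.Icc (∫ x in (-π)..π, g (s * P x + -(|s| * p)))
      (∫ x in (-π)..π, g (s * P x + |s| * p)) := by
    constructor
    · rw [← neg_nonneg, ← intervalIntegral.integral_neg]
      refine intervalIntegral.integral_nonneg hπ fun x _ => neg_nonneg.2 ?_
      rw [← h.inv_zero]
      exact h.inv_strictMono.monotone (by linarith [(abs_le.1 (hsP x)).2])
    · refine intervalIntegral.integral_nonneg hπ fun x _ => ?_
      rw [← h.inv_zero]
      exact h.inv_strictMono.monotone (by linarith [(abs_le.1 (hsP x)).1])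
  obtain ⟨η, hη, hη0⟩ := intermediate_value_Icc (by linarith) hc.continuousOn hmem
  exact ⟨η, hη0, abs_le.2 hη⟩

/-- The multiplier `η` depends on the factor `s` in a Lipschitz continuous way. -/
lemma shift_sub_le (h : PinchedPotential c C F f g) (hP : Continuous P) (hp : ∀ x, |P x| ≤ p)
    {s t η θ : ℝ} (hs : ∫ x in (-π)..π, g (s * P x + η) = 0)
    (ht : ∫ x in (-π)..π, g (t * P x + θ) = 0) : θ - η ≤ p * |t - s| := by
  by_contra! hlt
  have hg := h.continuous_inv
  have hπ : -π < π := by linarith [Real.pi_pos]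
  have : ∫ x in (-π)..π, g (s * P x + η) < ∫ x in (-π)..π, g (t * P x + θ) := by
    have key : ∀ x, g (s * P x + η) < g (t * P x + θ) := fun x => by
      refine h.inv_strictMono ?_
      have h1 : |(t - s) * P x| ≤ p * |t - s| := by
        rw [abs_mul, mul_comm]; exact mul_le_mul_of_nonneg_right (hp x) (abs_nonneg _)
      have := (abs_le.1 h1).1
      linarith
    exact intervalIntegral.integral_lt_integral_of_continuousOn_of_le_of_exists_lt hπ
      (Continuous.continuousOn (by fun_prop)) (Continuous.continuousOn (by fun_prop))
      (fun x _ => (key x).le) ⟨0, ⟨by linarith, by linarith⟩, key 0⟩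
  rw [hs, ht] at this
  exact lt_irrefl _ this

/-- Lower bound for the energy, which forces it to exceed every level for large `s`. -/
lemma energy_lower_bound (h : PinchedPotential c C F f g) (hP : Continuous P)
    (hP0 : ∫ x in (-π)..π, P x = 0) {s η : ℝ} (hs : 0 < s) :
    c / 2 * (s ^ 2 / C ^ 2 * ∫ x in (-π)..π, P x ^ 2)
      ≤ ∫ x in (-π)..π, F (g (s * P x + η)) := by
  have hg := h.continuous_inv
  have hF := h.continuous_pot
  have hC := h.C_pos
  have hc := h.c_pos
  have hpt : ∀ x, c / 2 * (s ^ 2 / C ^ 2 * P x ^ 2 + 2 * (s / C) * g η * P x)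
      ≤ F (g (s * P x + η)) := fun x => by
    refine le_trans ?_ (h.lower_sq _)
    refine mul_le_mul_of_nonneg_left ?_ (by positivity)
    have h1 := h.sq_div_le_mul_inv_sub (s * P x + η) η
    rw [add_sub_cancel_right] at h1
    set u := g (s * P x + η)
    have h2 := sq_nonneg (u - s / C * P x)
    have h3 : s ^ 2 / C ^ 2 * P x ^ 2 ≤ s / C * P x * (u - g η) := by
      calc s ^ 2 / C ^ 2 * P x ^ 2 = (s * P x) ^ 2 / C / C := by field_simp
        _ ≤ (s * P x * (u - g η)) / C := by gcongr
        _ = _ := by ring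
    have h4 : (s / C * P x) ^ 2 = s ^ 2 / C ^ 2 * P x ^ 2 := by ring
    nlinarith
  calc c / 2 * (s ^ 2 / C ^ 2 * ∫ x in (-π)..π, P x ^ 2)
      = ∫ x in (-π)..π, c / 2 * (s ^ 2 / C ^ 2 * P x ^ 2 + 2 * (s / C) * g η * P x) := by
        rw [intervalIntegral.integral_const_mul, intervalIntegral.integral_add
          (Continuous.intervalIntegrable (by fun_prop) _ _)
          (Continuous.intervalIntegrable (by fun_prop) _ _),
          intervalIntegral.integral_const_mul, intervalIntegral.integral_const_mul, hP0]
        ring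
    _ ≤ _ := intervalIntegral.integral_mono (by linarith [Real.pi_pos])
        (Continuous.intervalIntegrable (by fun_prop) _ _)
        (Continuous.intervalIntegrable (by fun_prop) _ _) hpt

/-- For a non-trivial zero-mean function `P` and every energy level `Γ` there are multipliers
such that `g (s P + η)`, where `g` inverts the derivative of the potential, has zero mean and
energy `Γ`. -/
lemma exists_multipliers (h : PinchedPotential c C F f g) (hP : Continuous P)
    (hp : ∀ x, |P x| ≤ p) (hP0 : ∫ x in (-π)..π, P x = 0)
    (hP2 : 0 < ∫ x in (-π)..π, P x ^ 2) {Γ : ℝ} (hΓ : 0 < Γ) :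
    ∃ s η, 0 < s ∧ |η| ≤ s * p ∧ ∫ x in (-π)..π, g (s * P x + η) = 0 ∧
      ∫ x in (-π)..π, F (g (s * P x + η)) = Γ := by
  have hg := h.continuous_inv
  have hF := h.continuous_pot
  have hC := h.C_pos
  have hc := h.c_pos
  choose η hη0 hηb using h.exists_shift hP hp
  have hp0 : 0 ≤ p := (abs_nonneg _).trans (hp 0)
  have hηc : Continuous η :=
    (LipschitzWith.of_dist_le_mul (K := ⟨p, hp0⟩) fun s t => by
      rw [Real.dist_eq, Real.dist_eq, abs_le]
      change -(p * |s - t|) ≤ _ ∧ _ ≤ p * |s - t|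
      have h1 := h.shift_sub_le hP hp (hη0 s) (hη0 t)
      have h2 := h.shift_sub_le hP hp (hη0 t) (hη0 s)
      rw [abs_sub_comm] at h1
      exact ⟨by linarith, h2⟩).continuous
  have hec : Continuous fun s => ∫ x in (-π)..π, F (g (s * P x + η s)) :=
    intervalIntegral.continuous_parametric_intervalIntegral_of_continuous'
      (by unfold Function.uncurry; fun_prop) _ _
  have he0 : ∫ x in (-π)..π, F (g (0 * P x + η 0)) = 0 := by
    have : η 0 = 0 := by simpa using hηb 0
    simp [this, h.inv_zero, h.F_zero]
  set m := ∫ x in (-π)..π, P x ^ 2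
  obtain ⟨S, hS, hSe⟩ : ∃ S, 0 < S ∧ c / 2 * (S ^ 2 / C ^ 2 * m) = Γ := by
    refine ⟨Real.sqrt (2 * Γ * C ^ 2 / (c * m)), Real.sqrt_pos.2 (by positivity), ?_⟩
    rw [Real.sq_sqrt (by positivity)]
    field_simp
  obtain ⟨s, hs, hse⟩ := intermediate_value_Icc hS.le hec.continuousOn
    (show Γ ∈ _ from ⟨he0.trans_le hΓ.le, hSe ▸ h.energy_lower_bound hP hP0 hS⟩)
  have hs0 : 0 < s := lt_of_le_of_ne hs.1 fun hs' => by
    subst hs'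
    exact hΓ.ne' (hse.symm.trans he0)
  refine ⟨s, η s, hs0, ?_, hη0 s, hse⟩
  simpa [abs_of_pos hs0] using hηb s

end PinchedPotential

/-! ### Existence of a maximizer among Lipschitz profiles -/

/-- The admissible profiles of the variational problem: profiles that are bounded by `M`,
Lipschitz continuous with constant `L`, and have energy `∫ F(Q)` at most `Γ`. The first two
bounds make the set compact in the uniform topology. -/
structure IsAdmissible (F : ℝ → ℝ) (M L Γ : ℝ) (Q : ℝ → ℝ) : Prop where
  isProfile : IsProfile Q
  bound : ∀ x, |Q x| ≤ M
  lip : ∀ x y, |Q x - Q y| ≤ L * |x - y|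
  energy : ∫ x in (-π)..π, F (Q x) ≤ Γ

lemma exists_coe_eq_and_abs_eq_norm {p : ℝ} (a : AddCircle p) :
    ∃ x : ℝ, (x : AddCircle p) = a ∧ |x| = ‖a‖ := by
  induction a using QuotientAddGroup.induction_on with
  | H x =>
    refine ⟨x - round (p⁻¹ * x) * p, ?_, (AddCircle.norm_eq p).symm⟩
    rw [AddCircle.coe_sub, ← zsmul_eq_mul, AddCircle.coe_zsmul, AddCircle.coe_period,
      smul_zero, sub_zero]

open scoped BoundedContinuousFunction in
/-- Compactness is stated on the circle, where `2π`-periodic functions become functions on a compact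
space and the Arzelà-Ascoli theorem applies. -/
lemma isCompact_admissible {F : ℝ → ℝ} (hF : Continuous F) (M L Γ : ℝ) :
    IsCompact {g : AddCircle (2 * π) →ᵇ ℝ | IsAdmissible F M L Γ fun x : ℝ => g x} := by
  have : Fact (0 < 2 * π) := ⟨Real.two_pi_pos⟩
  refine BoundedContinuousFunction.arzela_ascoli₂ (Set.Icc (-M) M) isCompact_Icc _ ?_ ?_ ?_
  · have hev : ∀ x : ℝ, Continuous fun g : AddCircle (2 * π) →ᵇ ℝ => g x := fun x =>
      continuous_eval_const (x : AddCircle (2 * π))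
    have hjoint : Continuous fun z : (AddCircle (2 * π) →ᵇ ℝ) × ℝ => z.1 z.2 := by
      fun_prop
    have hint : ∀ {G : ℝ → ℝ}, Continuous G → Continuous fun g : AddCircle (2 * π) →ᵇ ℝ =>
        ∫ x in (-π)..π, G (g x) := fun {G} hG =>
      intervalIntegral.continuous_parametric_intervalIntegral_of_continuous'
        (f := fun (g : AddCircle (2 * π) →ᵇ ℝ) (x : ℝ) => G (g x)) (hG.comp hjoint) _ _
    have heq : {g : AddCircle (2 * π) →ᵇ ℝ | IsAdmissible F M L Γ fun x : ℝ => g x}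
        = {g | ∫ x in (-π)..π, g (x : ℝ) = 0} ∩ {g | ∀ x : ℝ, g (-x : ℝ) = g x}
          ∩ {g | ∀ x ∈ Set.Icc (-π) 0, ∀ y ∈ Set.Icc (-π) 0, x ≤ y → g (x : ℝ) ≤ g (y : ℝ)}
          ∩ {g | ∀ x : ℝ, |g x| ≤ M} ∩ {g | ∀ x y : ℝ, |g x - g y| ≤ L * |x - y|}
          ∩ {g | ∫ x in (-π)..π, F (g (x : ℝ)) ≤ Γ} := by
      ext g
      constructor
      · rintro ⟨⟨-, -, h1, h2, h3⟩, h4, h5, h6⟩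
        exact ⟨⟨⟨⟨⟨h1, h2⟩, h3⟩, h4⟩, h5⟩, h6⟩
      · rintro ⟨⟨⟨⟨⟨h1, h2⟩, h3⟩, h4⟩, h5⟩, h6⟩
        exact ⟨⟨g.continuous.comp continuous_quotient_mk', fun x => by simp, h1, h2, h3⟩,
          h4, h5, h6⟩
    rw [heq]
    simp only [Set.ofPred_forall]
    refine ((((IsClosed.inter ?_ ?_).inter ?_).inter ?_).inter ?_).inter ?_
    · exact isClosed_eq (hint continuous_id) continuous_const
    · exact isClosed_iInter fun x => isClosed_eq (hev _) (hev _)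
    · exact isClosed_iInter fun x => isClosed_iInter fun _ => isClosed_iInter fun y =>
        isClosed_iInter fun _ => isClosed_iInter fun _ => isClosed_le (hev _) (hev _)
    · exact isClosed_iInter fun x => isClosed_le (hev _).abs continuous_const
    · exact isClosed_iInter fun x => isClosed_iInter fun y =>
        isClosed_le ((hev _).sub (hev _)).abs continuous_const
    · exact isClosed_le (hint hF) continuous_const
  · intro g a hg
    obtain ⟨x, rfl, -⟩ := exists_coe_eq_and_abs_eq_norm a
    exact abs_le.1 (hg.bound x)
  · refine Metric.equicontinuous_of_continuity_modulus (fun r => L * r) ?_ _ ?_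
    · simpa using (continuous_const_mul L).tendsto 0
    · rintro a b ⟨g, hg⟩
      obtain ⟨x, rfl, -⟩ := exists_coe_eq_and_abs_eq_norm b
      obtain ⟨d, hd, hd'⟩ := exists_coe_eq_and_abs_eq_norm (a - (x : AddCircle (2 * π)))
      have := hg.lip (x + d) x
      rw [dist_eq_norm a, ← hd', Real.dist_eq]
      rw [AddCircle.coe_add, hd] at this
      simpa using this

/-- The quadratic form of `A_k` attains its maximum over the admissible profiles. -/
lemma exists_maximizer {F : ℝ → ℝ} (hF : Continuous F) {M L Γ : ℝ} (k : ℝ) {Q₀ : ℝ → ℝ}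
    (h₀ : IsAdmissible F M L Γ Q₀) :
    ∃ Q, IsAdmissible F M L Γ Q ∧ ∀ R, IsAdmissible F M L Γ R →
      ∫ x in (-π)..π, opA k R x * R x ≤ ∫ x in (-π)..π, opA k Q x * Q x := by
  have : Fact (0 < 2 * π) := ⟨Real.two_pi_pos⟩
  have hjoint : Continuous fun z : (BoundedContinuousFunction (AddCircle (2 * π)) ℝ) × ℝ =>
      z.1 z.2 := by
    fun_prop
  have hA : Continuous fun z : (BoundedContinuousFunction (AddCircle (2 * π)) ℝ) × ℝ =>
      opA k (fun x : ℝ => z.1 x) z.2 := by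
    simp_rw [opA_eq]
    refine continuous_const.mul
      (intervalIntegral.continuous_parametric_intervalIntegral_of_continuous' ?_ _ _)
    exact hjoint.comp (f := fun w : ((BoundedContinuousFunction (AddCircle (2 * π)) ℝ) × ℝ) × ℝ =>
      (w.1.1, w.1.2 + w.2)) (by fun_prop)
  have hW : Continuous fun g : BoundedContinuousFunction (AddCircle (2 * π)) ℝ =>
      ∫ x in (-π)..π, opA k (fun x : ℝ => g x) x * g (x : ℝ) :=
    intervalIntegral.continuous_parametric_intervalIntegral_of_continuous'
      (f := fun (g : BoundedContinuousFunction (AddCircle (2 * π)) ℝ) (x : ℝ) =>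
        opA k (fun x : ℝ => g x) x * g x) (hA.mul hjoint) _ _
  -- every admissible profile descends to the circle
  have hlift : ∀ Q, IsAdmissible F M L Γ Q →
      ∃ g : BoundedContinuousFunction (AddCircle (2 * π)) ℝ, (fun x : ℝ => g x) = Q := fun Q hQ =>
    ⟨BoundedContinuousFunction.mkOfCompact ⟨hQ.isProfile.periodic.lift,
      continuous_coinduced_dom.2 hQ.isProfile.continuous⟩, rfl⟩
  obtain ⟨g₀, hg₀⟩ := hlift Q₀ h₀
  obtain ⟨g, hg, hmax⟩ := (isCompact_admissible hF M L Γ).exists_isMaxOn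
    ⟨g₀, show IsAdmissible F M L Γ _ by rw [hg₀]; exact h₀⟩ hW.continuousOn
  refine ⟨_, hg, fun R hR => ?_⟩
  obtain ⟨r, rfl⟩ := hlift R hR
  exact hmax hR

/-! ### The Euler-Lagrange equation -/

lemma IsEvenUnimodal.add_smul_sub {Q R : ℝ → ℝ} (hQ : IsEvenUnimodal Q) (hR : IsEvenUnimodal R)
    {t : ℝ} (ht : 0 ≤ t) (ht' : t ≤ 1) : IsEvenUnimodal fun x => Q x + t * (R x - Q x) :=
  ⟨fun x => by simp only [hQ.1 x, hR.1 x], fun x hx y hy hxy => by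
    have h1 := mul_le_mul_of_nonneg_left (hQ.2 hx hy hxy) (sub_nonneg.2 ht')
    have h2 := mul_le_mul_of_nonneg_left (hR.2 hx hy hxy) ht
    simp only
    linarith⟩

lemma abs_segment_le {a b m t : ℝ} (ha : |a| ≤ m) (hb : |b| ≤ m) (ht : 0 ≤ t) (ht' : t ≤ 1) :
    |a + t * (b - a)| ≤ m := by
  rw [abs_le] at *
  constructor <;> nlinarith

lemma PinchedPotential.segment_le {c C : ℝ} {F f g : ℝ → ℝ} (h : PinchedPotential c C F f g)
    {t : ℝ} (ht : 0 ≤ t) (ht' : t ≤ 1) (a b : ℝ) :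
    F (a + t * (b - a)) ≤ F a + t * (F b - F a) := by
  have hc := h.c_pos
  have h1 := h.lower_quad (a + t * (b - a)) a
  have h2 := h.lower_quad (a + t * (b - a)) b
  have h3 : 0 ≤ c / 2 * (a - (a + t * (b - a))) ^ 2 := by positivity
  have h4 : 0 ≤ c / 2 * (b - (a + t * (b - a))) ^ 2 := by positivity
  have h5 := mul_le_mul_of_nonneg_left (h1.trans' (le_add_of_nonneg_right h3)) (sub_nonneg.2 ht')
  have h6 := mul_le_mul_of_nonneg_left (h2.trans' (le_add_of_nonneg_right h4)) ht
  linarith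

/-- The admissible set is convex. -/
lemma IsAdmissible.add_smul_sub {c C M L Γ : ℝ} {F f g Q R : ℝ → ℝ}
    (h : PinchedPotential c C F f g) (hQ : IsAdmissible F M L Γ Q) (hR : IsAdmissible F M L Γ R)
    {t : ℝ} (ht : 0 ≤ t) (ht' : t ≤ 1) :
    IsAdmissible F M L Γ fun x => Q x + t * (R x - Q x) := by
  have hQc := hQ.isProfile.continuous
  have hRc := hR.isProfile.continuous
  have hF := h.continuous_pot
  refine ⟨⟨by fun_prop, fun x => ?_, ?_, ?_⟩, fun x => ?_, fun x y => ?_, ?_⟩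
  · simp only [hQ.isProfile.periodic x, hR.isProfile.periodic x]
  · rw [intervalIntegral.integral_add (hQc.intervalIntegrable _ _)
      (Continuous.intervalIntegrable (by fun_prop) _ _), intervalIntegral.integral_const_mul,
      intervalIntegral.integral_sub (hRc.intervalIntegrable _ _) (hQc.intervalIntegrable _ _),
      hQ.isProfile.integral_zero, hR.isProfile.integral_zero]
    ring
  · exact hQ.isProfile.even_unimodal.add_smul_sub hR.isProfile.even_unimodal ht ht'
  · exact abs_segment_le (hQ.bound x) (hR.bound x) ht ht'
  · have := abs_segment_le (hQ.lip x y) (hR.lip x y) ht ht'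
    convert this using 2
    ring
  · calc ∫ x in (-π)..π, F (Q x + t * (R x - Q x))
        ≤ ∫ x in (-π)..π, (F (Q x) + t * (F (R x) - F (Q x))) :=
          intervalIntegral.integral_mono (by linarith [Real.pi_pos])
            (Continuous.intervalIntegrable (by fun_prop) _ _)
            (Continuous.intervalIntegrable (by fun_prop) _ _) fun x => h.segment_le ht ht' _ _
      _ = (1 - t) * (∫ x in (-π)..π, F (Q x)) + t * ∫ x in (-π)..π, F (R x) := by
          rw [intervalIntegral.integral_add (Continuous.intervalIntegrable (by fun_prop) _ _)
            (Continuous.intervalIntegrable (by fun_prop) _ _),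
            intervalIntegral.integral_const_mul, intervalIntegral.integral_sub
            (Continuous.intervalIntegrable (by fun_prop) _ _)
            (Continuous.intervalIntegrable (by fun_prop) _ _)]
          ring
      _ ≤ Γ := by
          have h1 := mul_le_mul_of_nonneg_left hQ.energy (sub_nonneg.2 ht')
          have h2 := mul_le_mul_of_nonneg_left hR.energy ht
          linarith

lemma eq_zero_of_integral_sq_nonpos {h : ℝ → ℝ} (hc : Continuous h)
    (hper : Function.Periodic h (2 * π)) (h0 : ∫ x in (-π)..π, h x ^ 2 ≤ 0) (x : ℝ) :
    h x = 0 := by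
  by_contra hx
  have hpos : 0 < ∫ y in x..(x + 2 * π), h y ^ 2 :=
    intervalIntegral.integral_pos (by linarith [Real.pi_pos]) (hc.pow 2).continuousOn
      (fun y _ => sq_nonneg _) ⟨x, ⟨le_rfl, by linarith [Real.pi_pos]⟩, by positivity⟩
  have hper2 : Function.Periodic (fun y => h y ^ 2) (2 * π) := fun y => by simp only [hper y]
  have := hper2.intervalIntegral_add_eq x (-π)
  rw [show -π + 2 * π = π by ring] at this
  linarith

/-- Expansion of the quadratic form of `A_k` along a segment. -/
lemma integral_opA_segment {Q D : ℝ → ℝ} (hQ : Continuous Q) (hD : Continuous D)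
    (hQper : Function.Periodic Q (2 * π)) (hDper : Function.Periodic D (2 * π)) (k t : ℝ) :
    ∫ x in (-π)..π, opA k (fun y => Q y + t * D y) x * (Q x + t * D x)
      = (∫ x in (-π)..π, opA k Q x * Q x) + 2 * t * (∫ x in (-π)..π, opA k Q x * D x)
        + t ^ 2 * ∫ x in (-π)..π, opA k D x * D x := by
  have hAQ := continuous_opA hQ k
  have hAD := continuous_opA hD k
  have hsymm := integral_opA_mul_comm hQ hD hQper hDper k
  calc ∫ x in (-π)..π, opA k (fun y => Q y + t * D y) x * (Q x + t * D x)
      = ∫ x in (-π)..π, (opA k Q x * Q x + t * (opA k Q x * D x) + t * (opA k D x * Q x)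
          + t ^ 2 * (opA k D x * D x)) := by
        refine intervalIntegral.integral_congr fun x _ => ?_
        simp only [opA_add_smul hQ hD]
        ring
    _ = _ := by
        rw [intervalIntegral.integral_add, intervalIntegral.integral_add,
          intervalIntegral.integral_add, intervalIntegral.integral_const_mul,
          intervalIntegral.integral_const_mul, intervalIntegral.integral_const_mul, ← hsymm]
        · ring
        all_goals exact Continuous.intervalIntegrable (by fun_prop) _ _

/-- First-order optimality: the derivative of the quadratic form at a maximizer, in the direction
of another admissible profile, is non-positive. -/
lemma integral_opA_mul_sub_nonpos {c C M L Γ k : ℝ} {F f g Q R : ℝ → ℝ}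
    (h : PinchedPotential c C F f g) (hQ : IsAdmissible F M L Γ Q) (hR : IsAdmissible F M L Γ R)
    (hmax : ∀ S, IsAdmissible F M L Γ S →
      ∫ x in (-π)..π, opA k S x * S x ≤ ∫ x in (-π)..π, opA k Q x * Q x) :
    ∫ x in (-π)..π, opA k Q x * (R x - Q x) ≤ 0 := by
  have hQc := hQ.isProfile.continuous
  have hRc := hR.isProfile.continuous
  by_contra! hd
  have hexp := integral_opA_segment (D := fun x => R x - Q x) hQc (hRc.sub hQc)
    hQ.isProfile.periodic (hR.isProfile.periodic.sub hQ.isProfile.periodic) k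
  set d := ∫ x in (-π)..π, opA k Q x * (R x - Q x)
  set X := ∫ x in (-π)..π, opA k (fun x => R x - Q x) x * (R x - Q x)
  obtain ⟨t, ht, ht1, htX⟩ : ∃ t, 0 < t ∧ t ≤ 1 ∧ t * (|X| + 1) ≤ d := by
    refine ⟨min 1 (d / (|X| + 1)), by positivity, min_le_left _ _, ?_⟩
    rw [← le_div_iff₀ (by positivity)]
    exact min_le_right _ _
  have h1 := hmax _ (hQ.add_smul_sub h hR ht.le ht1)
  rw [hexp t] at h1
  have h2 : 0 < t * (2 * d + t * X) := mul_pos ht (by nlinarith [neg_abs_le X])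
  nlinarith

/-- Uniform convexity of the potential, used by testing `f(R) = s P + η` with `R - Q`. -/
lemma PinchedPotential.improvement {c C s η : ℝ} {F f g P Q R : ℝ → ℝ}
    (h : PinchedPotential c C F f g) (hP : Continuous P) (hQ : Continuous Q) (hR : Continuous R)
    (hQ0 : ∫ x in (-π)..π, Q x = 0) (hR0 : ∫ x in (-π)..π, R x = 0)
    (hfR : ∀ x, f (R x) = s * P x + η)
    (hE : ∫ x in (-π)..π, F (Q x) ≤ ∫ x in (-π)..π, F (R x)) :
    c / 2 * ∫ x in (-π)..π, (R x - Q x) ^ 2 ≤ s * ∫ x in (-π)..π, P x * (R x - Q x) := by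
  have hF := h.continuous_pot
  have hpt : ∀ x, c / 2 * (R x - Q x) ^ 2
      ≤ (F (Q x) - F (R x)) + s * (P x * (R x - Q x)) + η * (R x - Q x) := fun x => by
    have := h.lower_quad (R x) (Q x)
    rw [hfR] at this
    nlinarith
  have := intervalIntegral.integral_mono (μ := volume) (a := -π) (b := π)
    (by linarith [Real.pi_pos])
    (Continuous.intervalIntegrable (by fun_prop) _ _)
    (Continuous.intervalIntegrable (by fun_prop) _ _) hpt
  rw [intervalIntegral.integral_const_mul, intervalIntegral.integral_add,
    intervalIntegral.integral_add, intervalIntegral.integral_sub,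
    intervalIntegral.integral_const_mul, intervalIntegral.integral_const_mul,
    intervalIntegral.integral_sub, hQ0, hR0] at this
  · linarith
  all_goals exact Continuous.intervalIntegrable (by fun_prop) _ _

/-- `∫ P²` is positive as soon as `P` pairs non-trivially with some function. -/
lemma integral_sq_pos_of_integral_mul_pos {P Q : ℝ → ℝ} (hP : Continuous P) (hQ : Continuous Q)
    (h : 0 < ∫ x in (-π)..π, P x * Q x) : 0 < ∫ x in (-π)..π, P x ^ 2 := by
  set w := ∫ x in (-π)..π, P x * Q x with hw
  set N := ∫ x in (-π)..π, Q x ^ 2 with hN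
  have hπ : -π ≤ π := by linarith [Real.pi_pos]
  have hN0 : 0 ≤ N := intervalIntegral.integral_nonneg hπ fun x _ => sq_nonneg _
  set t := w / (N + 1)
  have ht : 0 < t := by positivity
  have htN : t * (N + 1) = w := div_mul_cancel₀ _ (by positivity)
  have : 0 ≤ ∫ x in (-π)..π, (P x - t * Q x) ^ 2 :=
    intervalIntegral.integral_nonneg hπ fun x _ => sq_nonneg _
  have h2 : ∫ x in (-π)..π, (P x - t * Q x) ^ 2
      = (∫ x in (-π)..π, P x ^ 2) - 2 * t * w + t ^ 2 * N := by
    rw [hw, hN, ← intervalIntegral.integral_const_mul, ← intervalIntegral.integral_const_mul,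
      ← intervalIntegral.integral_sub, ← intervalIntegral.integral_add]
    · exact intervalIntegral.integral_congr fun x _ => by ring
    all_goals exact Continuous.intervalIntegrable (by fun_prop) _ _
  nlinarith

/-- Existence of profiles that solve `f(Q) = s A_k Q + η` with prescribed energy. -/
lemma PinchedPotential.exists_profile {c C k Γ : ℝ} {F f g : ℝ → ℝ}
    (h : PinchedPotential c C F f g) (hk : 0 < k) (hk' : k < π) (hΓ : 0 < Γ) :
    ∃ (Q : ℝ → ℝ) (s η : ℝ), IsProfile Q ∧ ∫ x in (-π)..π, F (Q x) = Γ ∧ 0 < s ∧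
      ∀ φ, f (Q φ) = s * opA k Q φ + η := by
  have hc := h.c_pos
  have hC := h.C_pos
  have hF := h.continuous_pot
  have hg := h.continuous_inv
  have hf := h.continuous_deriv
  have hπ := Real.pi_pos
  have hπ' : -π ≤ π := by linarith
  -- a test profile `ε cos` of small energy, on which the quadratic form is positive
  obtain ⟨ε, hε, hεΓ⟩ : ∃ ε, 0 < ε ∧ C / 2 * ε ^ 2 * (2 * π) = Γ := by
    refine ⟨Real.sqrt (Γ / (C * π)), Real.sqrt_pos.2 (by positivity), ?_⟩
    rw [Real.sq_sqrt (by positivity)]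
    field_simp
  set w := Real.sin k * ε ^ 2 * π with hw_def
  have hw : 0 < w := by
    have := Real.sin_pos_of_pos_of_lt_pi hk hk'
    positivity
  have hwcos : ∫ x in (-π)..π, opA k (fun y => ε * Real.cos y) x * (ε * Real.cos x) = w := by
    have : ∀ x, opA k (fun y => ε * Real.cos y) x * (ε * Real.cos x)
        = Real.sin k * ε ^ 2 * Real.cos x ^ 2 := fun x => by
      have h1 : opA k (fun y => ε * Real.cos y) x = ε * opA k Real.cos x := by
        rw [opA, opA, intervalIntegral.integral_const_mul]; ring
      rw [h1, opA_cos]; ring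
    simp_rw [this]
    rw [intervalIntegral.integral_const_mul, integral_cos_sq]
    simp [hw_def]
  -- `N` bounds `∫ Q²`, `p` bounds `A_k Q`, `s₀` bounds the multiplier; `M` and `L` are the bounds
  -- that these imply for `f⁻¹(s A_k Q + η)` and its derivative
  set N := 2 * Γ / c
  set p := 1 / 4 * (2 * π + N)
  set s₀ := C * N / w
  set M := max ε (2 * (s₀ * p) / c)
  set L := max ε (s₀ * M / c)
  have hsq : ∀ S, Continuous S → ∫ x in (-π)..π, F (S x) ≤ Γ → ∫ x in (-π)..π, S x ^ 2 ≤ N := by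
    intro S hS hSΓ
    have := intervalIntegral.integral_mono (μ := volume) hπ'
      (Continuous.intervalIntegrable (by fun_prop) _ _)
      (Continuous.intervalIntegrable (by fun_prop) _ _) fun x => h.lower_sq (S x)
    rw [intervalIntegral.integral_const_mul] at this
    rw [le_div_iff₀ hc]
    linarith
  have hadm : IsAdmissible F M L Γ fun x => ε * Real.cos x := by
    refine ⟨isProfile_cos hε.le, fun x => ?_, fun x y => ?_, ?_⟩
    · rw [abs_mul, abs_of_pos hε]
      exact (mul_le_of_le_one_right hε.le (Real.abs_cos_le_one x)).trans (le_max_left _ _)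
    · rw [← mul_sub, abs_mul, abs_of_pos hε]
      exact mul_le_mul (le_max_left _ _) (Real.abs_cos_sub_cos_le x y) (abs_nonneg _)
        (hε.le.trans (le_max_left _ _))
    · have := intervalIntegral.integral_mono (μ := volume) (f := fun x => F (ε * Real.cos x))
        (g := fun _ => C / 2 * ε ^ 2) hπ'
        (Continuous.intervalIntegrable (by fun_prop) _ _)
        (Continuous.intervalIntegrable (by fun_prop) _ _) fun x => by
          refine (h.upper_quad _).trans (?_ : _ ≤ C / 2 * ε ^ 2)
          refine mul_le_mul_of_nonneg_left ?_ (by positivity)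
          rw [mul_pow]
          exact mul_le_of_le_one_right (by positivity) (Real.cos_sq_le_one x)
      refine this.trans ?_
      rw [intervalIntegral.integral_const, smul_eq_mul]
      linarith
  obtain ⟨Q, hQ, hmax⟩ := exists_maximizer hF k hadm
  have hQp := hQ.isProfile
  have hQc := hQp.continuous
  have hPp := hQp.opA hk hk'
  have hPc := hPp.continuous
  have hPQ : w ≤ ∫ x in (-π)..π, opA k Q x * Q x := hwcos ▸ hmax _ hadm
  have hPb : ∀ x, |opA k Q x| ≤ p := fun x => by
    refine (abs_opA_le hQc hQp.periodic hk hk' x).trans ?_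
    have := hsq Q hQc hQ.energy
    simp only [p]
    linarith
  have hp0 : 0 ≤ p := (abs_nonneg _).trans (hPb 0)
  obtain ⟨s, η, hs, hηb, hR0, hRΓ⟩ := h.exists_multipliers hPc hPb hPp.integral_zero
    (integral_sq_pos_of_integral_mul_pos hPc hQc (hw.trans_le hPQ)) hΓ
  set R := fun x => g (s * opA k Q x + η) with hRdef
  have hRc : Continuous R := by fun_prop
  have hfR : ∀ x, f (R x) = s * opA k Q x + η := fun x => h.right_inv _
  have himp := h.improvement hPc hQc hRc hQp.integral_zero hR0 hfR
    (hQ.energy.trans hRΓ.ge)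
  have hD0 : 0 ≤ ∫ x in (-π)..π, (R x - Q x) ^ 2 :=
    intervalIntegral.integral_nonneg hπ' fun x _ => sq_nonneg _
  have hs₀ : s ≤ s₀ := by
    have h1 : ∫ x in (-π)..π, opA k Q x * (R x - Q x)
        = (∫ x in (-π)..π, opA k Q x * R x) - ∫ x in (-π)..π, opA k Q x * Q x := by
      rw [← intervalIntegral.integral_sub]
      · exact intervalIntegral.integral_congr fun x _ => by ring
      all_goals exact Continuous.intervalIntegrable (by fun_prop) _ _
    have h2 : 0 ≤ s * ∫ x in (-π)..π, opA k Q x * (R x - Q x) :=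
      himp.trans' (mul_nonneg (by positivity) hD0)
    have h3 : w ≤ ∫ x in (-π)..π, opA k Q x * R x := by
      have := nonneg_of_mul_nonneg_right h2 hs
      linarith
    have h4 : s * (∫ x in (-π)..π, opA k Q x * R x) ≤ C * N := by
      have h5 := intervalIntegral.integral_mono (μ := volume) hπ'
        (Continuous.intervalIntegrable (by fun_prop) _ _)
        (Continuous.intervalIntegrable (by fun_prop) _ _) fun x => h.mul_self_le (R x)
      have h6 : ∫ x in (-π)..π, f (R x) * R x = s * ∫ x in (-π)..π, opA k Q x * R x := by
        have : ∀ x, f (R x) * R x = s * (opA k Q x * R x) + η * R x := fun x => by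
          rw [hfR]; ring
        simp_rw [this]
        rw [intervalIntegral.integral_add, intervalIntegral.integral_const_mul,
          intervalIntegral.integral_const_mul, hR0]
        · ring
        all_goals exact Continuous.intervalIntegrable (by fun_prop) _ _
      rw [h6, intervalIntegral.integral_const_mul] at h5
      exact h5.trans (mul_le_mul_of_nonneg_left (hsq R hRc hRΓ.le) hC.le)
    rw [le_div_iff₀ hw]
    exact (mul_le_mul_of_nonneg_left h3 hs.le).trans h4
  -- hence the improved profile is again admissible
  have hRadm : IsAdmissible F M L Γ R := by
    refine ⟨⟨hRc, fun x => ?_, hR0, fun x => ?_, fun x hx y hy hxy => ?_⟩,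
      fun x => ?_, fun x y => ?_, hRΓ.le⟩
    · simp only [hRdef, hPp.periodic x]
    · simp only [hRdef, hPp.even_unimodal.1 x]
    · refine h.inv_strictMono.monotone ?_
      have := mul_le_mul_of_nonneg_left (hPp.even_unimodal.2 hx hy hxy) hs.le
      linarith
    · refine le_trans ?_ (le_max_right _ _)
      have h1 := h.abs_inv_sub_le (s * opA k Q x + η) 0
      rw [h.inv_zero, sub_zero, sub_zero] at h1
      refine h1.trans ?_
      gcongr
      calc |s * opA k Q x + η| ≤ |s * opA k Q x| + |η| := abs_add_le _ _
        _ ≤ s * p + s * p := by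
            refine add_le_add ?_ hηb
            rw [abs_mul, abs_of_pos hs]
            exact mul_le_mul_of_nonneg_left (hPb x) hs.le
        _ = 2 * (s * p) := by ring
        _ ≤ 2 * (s₀ * p) := by gcongr
    · have h1 := h.abs_inv_sub_le (s * opA k Q x + η) (s * opA k Q y + η)
      rw [add_sub_add_right_eq_sub, ← mul_sub, abs_mul, abs_of_pos hs] at h1
      refine h1.trans ?_
      calc s * |opA k Q x - opA k Q y| / c ≤ s₀ * (M * |x - y|) / c := by
            gcongr
            exact abs_opA_sub_le hQc hQ.bound k x y
        _ = s₀ * M / c * |x - y| := by ring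
        _ ≤ L * |x - y| := mul_le_mul_of_nonneg_right (le_max_right _ _) (abs_nonneg _)
  -- so optimality of `Q` forces it to coincide with `Q`
  have hopt := integral_opA_mul_sub_nonpos h hQ hRadm hmax
  have hD : ∫ x in (-π)..π, (R x - Q x) ^ 2 ≤ 0 := by
    have := himp.trans (mul_nonpos_of_nonneg_of_nonpos hs.le hopt)
    by_contra! hlt
    have := mul_pos (half_pos hc) hlt
    linarith
  have hRQ : R = Q := funext fun x => sub_eq_zero.1 <|
    eq_zero_of_integral_sq_nonpos (h := fun x => R x - Q x) (hRc.sub hQc)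
      (hRadm.isProfile.periodic.sub hQp.periodic) hD x
  refine ⟨Q, s, η, hQp, ?_, hs, fun φ => ?_⟩
  · rw [← hRQ]; exact hRΓ
  · rw [← hfR, hRQ]

/-! ### From profiles to wavetrains -/

lemma mean_eq_zero_iff {P : ℝ → ℝ} : mean P = 0 ↔ ∫ x in (-π)..π, P x = 0 := by
  simp [mean, Real.pi_ne_zero]

lemma IsProfile.inCone {Q : ℝ → ℝ} (hQ : IsProfile Q) : InCone Q where
  periodic := hQ.periodic
  memLp := (memLp_two_iff_integrable_sq
    hQ.continuous.aestronglyMeasurable).2 (hQ.continuous.pow 2).continuousOn.integrableOn_Icc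
  mean_zero := mean_eq_zero_iff.2 hQ.integral_zero
  shape := Filter.Eventually.of_forall fun p h1 h2 h3 => by
    obtain ⟨heven, hmono⟩ := hQ.even_unimodal
    refine ⟨heven _, ?_⟩
    rw [← heven p.1, ← heven p.2]
    exact hmono ⟨by linarith, by linarith⟩ ⟨by linarith, by linarith⟩ (by linarith)

/-- The solution of the travelling wave equation for a general wave number `k`; both parts of the
main result are instances. -/
lemma exists_wavetrain {Φ Ψ : ℝ → ℝ} (hΦ : StrictConvexOn ℝ Set.univ Φ)
    (hΨΦ : IsLegendreTransform Φ Ψ) (hΨ : ContDiff ℝ 2 Ψ) {c C : ℝ} (hc : 0 < c)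
    (hbounds : ∀ ζ : ℝ, c ≤ deriv (deriv Ψ) ζ ∧ deriv (deriv Ψ) ζ ≤ C)
    {k κ γ : ℝ} (q : ℝ) (hk : 0 < k) (hk' : k < π) (hκ : 0 < κ) (hγ : 0 < γ) :
    ∃ (Q : ℝ → ℝ) (σ η : ℝ), InCone Q ∧ IsEvenUnimodal Q ∧ Continuous Q ∧
      energyW Ψ q Q = γ ∧ 0 < σ ∧
      (∀ φ, σ * (deriv (normPot Ψ q) (Q φ) - η) = κ⁻¹ * opA k Q φ) ∧
      InCone (profile Ψ q η Q) ∧ IsEvenUnimodal (profile Ψ q η Q) ∧ 0 < κ * σ ∧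
      IsWavetrain Φ k (κ * σ) (η + deriv Ψ q) (profile Ψ q η Q) ∧
      IsDualProfile Φ (η + deriv Ψ q) (profile Ψ q η Q) q Q := by
  have hπ := Real.pi_pos
  obtain ⟨g, hpot⟩ := exists_pinchedPotential_normPot hΨ hc hbounds q
  obtain ⟨Q, s, η, hQ, hE, hs, heq⟩ :=
    hpot.exists_profile hk hk' (Γ := 2 * π * γ) (by positivity)
  have hVeq : profile Ψ q η Q = fun φ => s * opA k Q φ := funext fun φ => by
    rw [profile, heq]; ring
  have hAQ := hQ.opA hk hk'
  have hV : IsProfile (profile Ψ q η Q) := by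
    rw [hVeq]
    exact ⟨hAQ.continuous.const_mul s |>.congr fun _ => rfl,
      fun x => by simp only [hAQ.periodic x],
      by rw [intervalIntegral.integral_const_mul, hAQ.integral_zero, mul_zero],
      fun x => by simp only [hAQ.even_unimodal.1 x],
      fun x hx y hy hxy => mul_le_mul_of_nonneg_left (hAQ.even_unimodal.2 hx hy hxy) hs.le⟩
  have hdV : ∀ φ, HasDerivAt (profile Ψ q η Q) (s * nabla k Q φ) φ := fun φ => by
    rw [hVeq]; exact (hasDerivAt_opA hQ.continuous k φ).const_mul s
  have hdual : ∀ φ, deriv Φ (η + deriv Ψ q + profile Ψ q η Q φ) = q + Q φ := fun φ => by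
    rw [profile, (hasDerivAt_normPot hΨ q (Q φ)).deriv,
      show η + deriv Ψ q + (deriv Ψ (q + Q φ) - deriv Ψ q - η) = deriv Ψ (q + Q φ) by ring]
    exact deriv_legendre_comp hΦ.convexOn hΨΦ hΨ hc (fun ζ => (hbounds ζ).1) _
  have hω : κ * (κ⁻¹ * s⁻¹) = s⁻¹ := by field_simp
  have hωV : ∀ φ, s⁻¹ * (s * nabla k Q φ) = nabla k Q φ := fun φ => by field_simp
  refine ⟨Q, κ⁻¹ * s⁻¹, η, hQ.inCone, hQ.even_unimodal, hQ.continuous, ?_, by positivity,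
    fun φ => ?_, hV.inCone, hV.even_unimodal, by positivity, ?_, hdual, ?_⟩
  · rw [energyW, mean, hE]
    field_simp
  · rw [heq]; field_simp; ring
  · rw [hω]
    refine ⟨hV.periodic, mean_eq_zero_iff.2 hV.integral_zero,
      fun φ => (hdV φ).differentiableAt, fun φ => ?_, fun j => ?_⟩
    · rw [(hdV φ).deriv, hωV]
      simp only [nabla, hdual]
      ring
    · have hu : ∀ t, HasDerivAt
          (fun t => η + deriv Ψ q + profile Ψ q η Q (k * (j : ℝ) - s⁻¹ * t))
          (-nabla k Q (k * (j : ℝ) - s⁻¹ * t)) t := fun t => by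
        have h1 : HasDerivAt (fun t => k * (j : ℝ) - s⁻¹ * t) (-s⁻¹) t := by
          simpa using ((hasDerivAt_id t).const_mul s⁻¹).const_sub (k * (j : ℝ))
        refine ((HasDerivAt.comp t (hdV _) h1).const_add (η + deriv Ψ q)).congr_deriv ?_
        rw [mul_neg, mul_comm, hωV]
      refine ⟨fun t => (hu t).differentiableAt, fun t => ?_⟩
      simp only [(hu t).deriv, hdual, nabla]
      push_cast
      rw [show k * ((j : ℝ) + 1) - s⁻¹ * t = k * j - s⁻¹ * t + k by ring,
        show k * ((j : ℝ) - 1) - s⁻¹ * t = k * j - s⁻¹ * t - k by ring]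
      ring
  · simp_rw [hdual]
    rw [mean, intervalIntegral.integral_add (by simp) (hQ.continuous.intervalIntegrable _ _),
      hQ.integral_zero]
    simp
    field_simp
    ring

end Wavetrain

theorem mainTheorem1 (Φ Ψ : ℝ → ℝ) (hΦ : StrictConvexOn ℝ Set.univ Φ)
    (hΨΦ : Wavetrain.IsLegendreTransform Φ Ψ)
    (hΨ : ContDiff ℝ 2 Ψ) (c C : ℝ) (hc : 0 < c)
    (hbounds : ∀ ζ : ℝ, c ≤ deriv (deriv Ψ) ζ ∧ deriv (deriv Ψ) ζ ≤ C)
    (κ q γ : ℝ) (hκ : 0 < κ) (hκ' : κ ≤ π / 2) (hγ : 0 < γ) :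
    ∃ (Qhat Qtilde : ℝ → ℝ) (σhat σtilde ηhat ηtilde : ℝ),
      -- the solution for the wave number `κ`
      (Wavetrain.InCone Qhat ∧ Wavetrain.IsEvenUnimodal Qhat ∧ Continuous Qhat ∧
        Wavetrain.energyW Ψ q Qhat = γ ∧ 0 < σhat ∧
        (∀ φ : ℝ, σhat * (deriv (Wavetrain.normPot Ψ q) (Qhat φ) - ηhat)
          = Wavetrain.opBHat κ Qhat φ) ∧
        Wavetrain.InCone (Wavetrain.profile Ψ q ηhat Qhat) ∧
        Wavetrain.IsEvenUnimodal (Wavetrain.profile Ψ q ηhat Qhat) ∧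
        0 < κ * σhat ∧
        Wavetrain.IsWavetrain Φ κ (κ * σhat) (ηhat + deriv Ψ q)
          (Wavetrain.profile Ψ q ηhat Qhat) ∧
        Wavetrain.IsDualProfile Φ (ηhat + deriv Ψ q)
          (Wavetrain.profile Ψ q ηhat Qhat) q Qhat) ∧
      -- the solution for the wave number `π - κ`
      (Wavetrain.InCone Qtilde ∧ Wavetrain.IsEvenUnimodal Qtilde ∧ Continuous Qtilde ∧
        Wavetrain.energyW Ψ q Qtilde = γ ∧ 0 < σtilde ∧
        (∀ φ : ℝ, σtilde * (deriv (Wavetrain.normPot Ψ q) (Qtilde φ) - ηtilde)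
          = Wavetrain.opBTilde κ Qtilde φ) ∧
        Wavetrain.InCone (Wavetrain.profile Ψ q ηtilde Qtilde) ∧
        Wavetrain.IsEvenUnimodal (Wavetrain.profile Ψ q ηtilde Qtilde) ∧
        0 < κ * σtilde ∧
        Wavetrain.IsWavetrain Φ (π - κ) (κ * σtilde) (ηtilde + deriv Ψ q)
          (Wavetrain.profile Ψ q ηtilde Qtilde) ∧
        Wavetrain.IsDualProfile Φ (ηtilde + deriv Ψ q)
          (Wavetrain.profile Ψ q ηtilde Qtilde) q Qtilde) := by
  have hπ := Real.pi_pos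
  obtain ⟨Q, σ, η, hQ⟩ := Wavetrain.exists_wavetrain hΦ hΨΦ hΨ hc hbounds (k := κ) q hκ
    (by linarith) hκ hγ
  obtain ⟨Q', σ', η', hQ'⟩ := Wavetrain.exists_wavetrain hΦ hΨΦ hΨ hc hbounds (k := π - κ) q
    (by linarith) (by linarith) hκ hγ
  exact ⟨Q, Q', σ, σ', η, η', hQ, hQ'⟩
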